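/- Let $n\ge p\ge 1$, and let $\mathcal M_{n\times p}(\mathbb R)$ carry the Frobenius inner product $\langle A,B\rangle=\operatorname{tr}(A^tB)$. Let $St_p^n=\{U\in\mathcal M_{n\times p}(\mathbb R): U^tU=\mathbb I_p\}$ be the orthogonal Stiefel manifold, an embedded submanifold of $\mathcal M_{n\times p}(\mathbb R)$, with the induced Riemannian metric, and let $\Delta_{St_p^n}$ be its Laplace–Beltrami operator (the trace, with respect to the metric, of the Riemannian Hessian). Identify $\mathcal M_{n\times p}(\mathbb R)$ with $\mathbb R^{np}$ by the column vectorization $\operatorname{vec}$. For a smooth function $f:\mathcal M_{n\times p}(\mathbb R)\to\mathbb R$ let $\nabla f(U)\in\mathcal M_{n\times p}(\mathbb R)$ be the Euclidean gradient, $\Delta f$ the Euclidean Laplacian, and $\operatorname{Hess}f(U)$ the $np\times np$ matrix of second partial derivatives with respect to $\operatorname{vec}$. For $U\in St_p^n$ with columns $\mathbf u_1,\dots,\mathbf u_p$ let $\Lambda(U)$ be the $np\times np$ matrix consisting of $p\times p$ blocks of size $n\times n$ whose $(i,j)$ block is $\mathbf u_j\mathbf u_i^t$. (a) Let $\widetilde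 f:St_p^n\to\mathbb R$ be a smooth function and let $f:\mathcal M_{n\times p}(\mathbb R)\to\mathbb R$ be any smooth extension of $\widetilde f$. Then for every $U\in St_p^n$ $$\Delta_{St_p^n}\widetilde f(U)=\Delta f(U)-\Big(n-\tfrac{p+1}{2}\Big)\operatorname{tr}\big(U^t\nabla f(U)\big)-\tfrac12\operatorname{tr}\Big(\big(\mathbb I_p\otimes UU^t+\Lambda(U)\big)\operatorname{Hess} f(U)\Big).$$ (b) For every $U\in St_p^n$ and every real matrix $T$ with $np$ rows whose columns form a basis of $\operatorname{vec}(T_USt_p^n)$, $$T(T^tT)^{-1}T^t=\mathbb I_{np}-\tfrac12\,\mathbb I_p\otimes UU^t-\tfrac12\Lambda(U).$$ -/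

import Mathlib

open scoped ContDiff Matrix Kronecker Matrix.Norms.Frobenius

noncomputable section

/-! ### Riemannian calculus in a coordinate chart of `ℝ^d` -/

section Coordinates

variable {d : ℕ} {F : Type*} [NormedAddCommGroup F] [NormedSpace ℝ F]

/-- The partial derivative `∂ᵢ h` at `x`. -/
def partialD (i : Fin d) (h : EuclideanSpace ℝ (Fin d) → F) (x : EuclideanSpace ℝ (Fin d)) : F :=
  fderiv ℝ h x (EuclideanSpace.single i 1)

/-- The Christoffel symbol (of the Levi-Civita connection)
`Γᵏᵢⱼ = ½ ∑ₗ gᵏˡ (∂ᵢ gⱼₗ + ∂ⱼ gᵢₗ - ∂ₗ gᵢⱼ)` of a metric `g` given in coordinates. -/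
def christoffel (g : EuclideanSpace ℝ (Fin d) → Matrix (Fin d) (Fin d) ℝ) (k i j : Fin d)
    (x : EuclideanSpace ℝ (Fin d)) : ℝ :=
  (1 / 2) * ∑ l, (g x)⁻¹ k l *
    (partialD i (fun y => g y j l) x + partialD j (fun y => g y i l) x
      - partialD l (fun y => g y i j) x)

/-- The matrix of the Riemannian Hessian (the second covariant derivative)
`(Hess h)ᵢⱼ = ∂ᵢ∂ⱼ h - ∑ₖ Γᵏᵢⱼ ∂ₖ h`. -/
def riemannianHessian (g : EuclideanSpace ℝ (Fin d) → Matrix (Fin d) (Fin d) ℝ)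
    (h : EuclideanSpace ℝ (Fin d) → ℝ) (x : EuclideanSpace ℝ (Fin d)) :
    Matrix (Fin d) (Fin d) ℝ :=
  Matrix.of fun i j =>
    partialD i (fun y => partialD j h y) x - ∑ k, christoffel g k i j x * partialD k h x

/-- The Laplace-Beltrami operator in coordinates: `tr (g⁻¹ Hess h)`. -/
def chartLaplaceBeltrami (g : EuclideanSpace ℝ (Fin d) → Matrix (Fin d) (Fin d) ℝ)
    (h : EuclideanSpace ℝ (Fin d) → ℝ) (x : EuclideanSpace ℝ (Fin d)) : ℝ :=
  Matrix.trace ((g x)⁻¹ * riemannianHessian g h x)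

end Coordinates

/-! ### Embedded submanifolds of a Euclidean space, with the induced metric -/

section Submanifold

variable {E : Type*} [NormedAddCommGroup E] [InnerProductSpace ℝ E]

/-- `φ` is a smooth local parametrization of the embedded submanifold `S`: it is a homeomorphism
of an open subset of `ℝ^d` onto a (relatively) open subset of `S`, and it is a smooth immersion
as a map into the ambient space. -/
structure IsLocalParametrization (S : Set E) {d : ℕ}
    (φ : OpenPartialHomeomorph (EuclideanSpace ℝ (Fin d)) S) : Prop where
  smooth : ContDiffOn ℝ ∞ (fun x => (φ x : E)) φ.source
  immersive : ∀ x ∈ φ.source, Function.Injective (fderiv ℝ (fun y => (φ y : E)) x)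

/-- The matrix `gᵢⱼ = ⟨∂ᵢ φ, ∂ⱼ φ⟩` of the induced metric in the coordinates given by `φ`. -/
def inducedMetric {d : ℕ} (φ : EuclideanSpace ℝ (Fin d) → E) (x : EuclideanSpace ℝ (Fin d)) :
    Matrix (Fin d) (Fin d) ℝ :=
  Matrix.of fun i j => inner ℝ (partialD i φ x) (partialD j φ x)

/-- A function on the submanifold `S` is smooth if it is smooth in all local coordinates. -/
def SmoothOnSubmanifold (S : Set E) (h : S → ℝ) : Prop :=
  ∀ (d : ℕ) (φ : OpenPartialHomeomorph (EuclideanSpace ℝ (Fin d)) S),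
    IsLocalParametrization S φ → ContDiffOn ℝ ∞ (fun x => h (φ x)) φ.source

/-- `S` is an embedded submanifold near `u`, and the Laplace-Beltrami operator of `S`, with the
metric induced from the ambient space, takes the value `L` on `h` at `u`: there are local
parametrizations around `u`, and computing in any of them gives `L`. -/
def HasLaplaceBeltramiAt (S : Set E) (h : S → ℝ) (u : S) (L : ℝ) : Prop :=
  (∃ (d : ℕ) (φ : OpenPartialHomeomorph (EuclideanSpace ℝ (Fin d)) S),
    IsLocalParametrization S φ ∧ u ∈ φ.target) ∧
  ∀ (d : ℕ) (φ : OpenPartialHomeomorph (EuclideanSpace ℝ (Fin d)) S),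
    IsLocalParametrization S φ → u ∈ φ.target →
      chartLaplaceBeltrami (inducedMetric fun x => (φ x : E)) (fun x => h (φ x)) (φ.symm u) = L

/-- The tangent space of `S` at `u`: the set of velocities of smooth curves in `S` through `u`. -/
def tangentVectors (S : Set E) (u : E) : Set E :=
  {v | ∃ (ε : ℝ) (γ : ℝ → E), 0 < ε ∧ ContDiffOn ℝ ∞ γ (Set.Ioo (-ε) ε) ∧
    (∀ t ∈ Set.Ioo (-ε) ε, γ t ∈ S) ∧ γ 0 = u ∧ deriv γ 0 = v}

end Submanifold

/-! ### Matrices with the Frobenius metric, and the Stiefel manifold -/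

/-- The Frobenius inner product `⟨A, B⟩ = tr (Aᵀ B)`; its norm is the Frobenius norm. -/
instance frobeniusInnerProductSpace (n p : ℕ) :
    InnerProductSpace ℝ (Matrix (Fin n) (Fin p) ℝ) where
  inner A B := Matrix.trace (Aᵀ * B)
  norm_sq_eq_re_inner A := by
    have h : (0 : ℝ) ≤ ∑ i, ∑ j, ‖A i j‖ ^ (2 : ℝ) := by positivity
    rw [Matrix.frobenius_norm_def, ← Real.sqrt_eq_rpow, Real.sq_sqrt h, Finset.sum_comm]
    simp [Matrix.trace, Matrix.mul_apply, sq]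
  conj_inner_symm A B := by
    simp [Matrix.trace, Matrix.mul_apply, mul_comm]
  add_left A B C := by
    simp [Matrix.add_mul]
  smul_left A B r := by
    simp

/-- The orthogonal Stiefel manifold `{U | Uᵀ U = I_p}` in the space of `n × p` matrices. -/
def stiefel (n p : ℕ) : Set (Matrix (Fin n) (Fin p) ℝ) :=
  {U | Uᵀ * U = 1}

section MatrixDefs

variable {n p : ℕ}

/-- The `np × np` matrix `Hess f (U)` of second partial derivatives of `f`, with respect to the
column vectorization: the row `(i, a)` and the column `(j, b)` belong to the entries
`u_{ai}` and `u_{bj}`. -/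
def hessianMatrix (f : Matrix (Fin n) (Fin p) ℝ → ℝ) (U : Matrix (Fin n) (Fin p) ℝ) :
    Matrix (Fin p × Fin n) (Fin p × Fin n) ℝ :=
  Matrix.of fun r s =>
    iteratedFDeriv ℝ 2 f U ![Matrix.single r.2 r.1 1, Matrix.single s.2 s.1 1]

/-- The `np × np` matrix `Λ(U)` whose `(i, j)` block is `u_j u_iᵀ`, where `u_i` is the `i`-th
column of `U`. -/
def lambdaMatrix (U : Matrix (Fin n) (Fin p) ℝ) :
    Matrix (Fin p × Fin n) (Fin p × Fin n) ℝ :=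
  Matrix.of fun r s => Matrix.vecMulVec (U.col s.1) (U.col r.1) r.2 s.2

/-- The columns of `T` are a basis of `vec (T_U St)`, where `T_U St` is the tangent space of the
Stiefel manifold at `U`. -/
def IsTangentFrame {k : ℕ} (U : Matrix (Fin n) (Fin p) ℝ)
    (T : Matrix (Fin p × Fin n) (Fin k) ℝ) : Prop :=
  LinearIndependent ℝ T.col ∧
    (Submodule.span ℝ (Set.range T.col) : Set (Fin p × Fin n → ℝ)) =
      Matrix.vec '' tangentVectors (stiefel n p) U

end MatrixDefs

end

/-! The tangent space at `U` consists of the `Z` with `Uᵀ Z` skew, and its orthogonal complement of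
the matrices `U S` with `S` symmetric. So the orthogonal projection onto it is `P Z = Z - ½ U (Uᵀ Z
+ Zᵀ U)` (`stiefelProj`). Vectorized, this is (b): `T (Tᵀ T)⁻¹ Tᵀ` is the projection onto the column
span of `T` (`gram_inv_sum_eq_of_mem_span`).

For (a), let `Φ` be a parametrization. For an induced metric the Christoffel term of the Hessian
removes exactly `Df` of the tangential part of `∂ᵢ∂ⱼΦ`, leaving `D²f(∂ᵢΦ, ∂ⱼΦ)` plus `Df` of the
normal part (`chartLaplaceBeltrami_comp`). Differentiating `Φᵀ Φ = 1` twice shows that this normal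
part is `-½ U (Yᵀ Z + Zᵀ Y)` with `Y = ∂ᵢΦ`, `Z = ∂ⱼΦ`. The Laplacian is therefore the trace over
the tangent space of one bilinear form `B`, which equals `∑ B(P e, e)` over an orthonormal basis `e`
of the ambient space (`sum_gram_inv_mul_bilin`), whatever the chart. Matrix units as `e` give the
stated formula.

Charts exist by the inverse function theorem (`exists_isLocalParametrization`). Their partial
derivatives span the tangent space because velocities of curves lie in the range of the
differential. -/

noncomputable section

/-! ### Orthogonal projections and traces through Gram matrices -/

section Gram

variable {E : Type*} [NormedAddCommGroup E] [InnerProductSpace ℝ E] {k : ℕ}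

/-- Normal equations: if `w = ∑ cᵢ vᵢ`, orthogonality of `z - w` to every `vₗ` says that the vector
of the `⟨vₗ, z⟩` is the Gram matrix applied to `c`, and the Gram matrix of an independent family is
invertible. -/
theorem gram_inv_sum_eq_of_mem_span {v : Fin k → E} (hv : LinearIndependent ℝ v) {z w : E}
    (hw : w ∈ Submodule.span ℝ (Set.range v)) (h : ∀ l, inner ℝ (v l) (z - w) = 0) :
    ∑ i, ∑ l, ((Matrix.gram ℝ v)⁻¹ i l * inner ℝ (v l) z) • v i = w := by
  have hdet : IsUnit (Matrix.gram ℝ v).det :=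
    ((Matrix.posDef_gram_of_linearIndependent hv).isUnit).map Matrix.detMonoidHom
  obtain ⟨c, rfl⟩ := (Submodule.mem_span_range_iff_exists_fun ℝ).1 hw
  have hz : ∀ l, inner ℝ (v l) z = (Matrix.gram ℝ v *ᵥ c) l := by
    intro l
    have := h l
    rw [inner_sub_right, sub_eq_zero] at this
    rw [this, inner_sum]
    simp [Matrix.mulVec, dotProduct, Matrix.gram, inner_smul_right, mul_comm]
  refine Finset.sum_congr rfl fun i _ => ?_
  rw [← Finset.sum_smul]
  congr 1
  have : ((Matrix.gram ℝ v)⁻¹ *ᵥ (Matrix.gram ℝ v *ᵥ c)) i = c i := by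
    rw [Matrix.mulVec_mulVec, Matrix.nonsing_inv_mul _ hdet, Matrix.one_mulVec]
  rw [← this]
  simp [hz, Matrix.mulVec, dotProduct]

theorem gram_inv_isSymm (v : Fin k → E) : (Matrix.gram ℝ v)⁻¹ᵀ = (Matrix.gram ℝ v)⁻¹ := by
  rw [Matrix.transpose_nonsing_inv]
  congr 1
  ext i j
  exact real_inner_comm _ _

/-- The trace of a bilinear form over a subspace, computed in a basis `v` of the subspace and in an
orthonormal basis of the ambient space. -/
theorem sum_gram_inv_mul_bilin {ι : Type*} [Fintype ι] (e : OrthonormalBasis ι ℝ E)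
    {v : Fin k → E} {P : E → E}
    (hP : ∀ z, ∑ i, ∑ l, ((Matrix.gram ℝ v)⁻¹ i l * inner ℝ (v l) z) • v i = P z)
    (B : E →ₗ[ℝ] E →ₗ[ℝ] ℝ) :
    ∑ i, ∑ j, (Matrix.gram ℝ v)⁻¹ i j * B (v i) (v j) = ∑ α, B (P (e α)) (e α) := by
  have h : ∀ α, B (P (e α)) (e α) =
      ∑ i, ∑ l, (Matrix.gram ℝ v)⁻¹ i l * (inner ℝ (v l) (e α) * B (v i) (e α)) := by
    intro α
    rw [← hP]
    simp [mul_assoc]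
  simp_rw [h]
  conv_rhs => rw [Finset.sum_comm]
  refine Finset.sum_congr rfl fun i _ => ?_
  rw [Finset.sum_comm]
  refine Finset.sum_congr rfl fun j _ => ?_
  rw [← Finset.mul_sum]
  congr 1
  -- Only the second argument `v j` is expanded in `e`; the first already carries the projection.
  rw [← congrArg (B (v i)) (e.sum_repr' (v j)), map_sum]
  refine Finset.sum_congr rfl fun α _ => ?_
  rw [map_smul, real_inner_comm, smul_eq_mul]

end Gram

/-! ### The Riemannian Hessian of an induced metric -/

section ChartHessian

variable {d : ℕ} {F : Type*} [NormedAddCommGroup F] [NormedSpace ℝ F]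

theorem hasFDerivAt_partialD {Φ : EuclideanSpace ℝ (Fin d) → F} {x : EuclideanSpace ℝ (Fin d)}
    (hΦ : ContDiffAt ℝ ∞ Φ x) (j : Fin d) :
    HasFDerivAt (fun y => partialD j Φ y)
      ((fderiv ℝ (fderiv ℝ Φ) x).flip (EuclideanSpace.single j 1)) x := by
  have h : DifferentiableAt ℝ (fderiv ℝ Φ) x :=
    (hΦ.fderiv_right (m := 1) (by norm_cast)).differentiableAt one_ne_zero
  simpa [partialD] using h.hasFDerivAt.clm_apply (hasFDerivAt_const (EuclideanSpace.single j 1) x)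

theorem partialD_partialD_comm {Φ : EuclideanSpace ℝ (Fin d) → F} {x : EuclideanSpace ℝ (Fin d)}
    (hΦ : ContDiffAt ℝ ∞ Φ x) (i j : Fin d) :
    partialD i (fun y => partialD j Φ y) x = partialD j (fun y => partialD i Φ y) x := by
  have hs : IsSymmSndFDerivAt ℝ Φ x := hΦ.isSymmSndFDerivAt (by simp; norm_cast)
  conv_lhs => rw [partialD, (hasFDerivAt_partialD hΦ j).fderiv]
  conv_rhs => rw [partialD, (hasFDerivAt_partialD hΦ i).fderiv]
  exact hs _ _

variable {E : Type*} [NormedAddCommGroup E] [InnerProductSpace ℝ E]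

theorem partialD_inducedMetric {Φ : EuclideanSpace ℝ (Fin d) → E} {x : EuclideanSpace ℝ (Fin d)}
    (hΦ : ContDiffAt ℝ ∞ Φ x) (i j l : Fin d) :
    partialD i (fun y => inducedMetric Φ y j l) x =
      inner ℝ (partialD i (fun y => partialD j Φ y) x) (partialD l Φ x)
        + inner ℝ (partialD j Φ x) (partialD i (fun y => partialD l Φ y) x) := by
  have hj := hasFDerivAt_partialD hΦ j
  have hl := hasFDerivAt_partialD hΦ l
  have h := (hj.inner ℝ hl).fderiv
  rw [partialD]
  simp only [inducedMetric, Matrix.of_apply]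
  rw [h]
  conv_rhs => simp only [partialD.eq_1 i, hj.fderiv, hl.fderiv]
  simp [fderivInnerCLM_apply, add_comm]

/-- Since mixed partials commute, four of the six terms given by the product rule cancel and the
other two agree. The symbols are thus the coordinates of the tangential projection of `∂ᵢ∂ⱼΦ`. -/
theorem christoffel_inducedMetric {Φ : EuclideanSpace ℝ (Fin d) → E}
    {x : EuclideanSpace ℝ (Fin d)} (hΦ : ContDiffAt ℝ ∞ Φ x) (k i j : Fin d) :
    christoffel (inducedMetric Φ) k i j x =
      ∑ l, (inducedMetric Φ x)⁻¹ k l *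
        inner ℝ (partialD l Φ x) (partialD i (fun y => partialD j Φ y) x) := by
  rw [christoffel, Finset.mul_sum]
  refine Finset.sum_congr rfl fun l _ => ?_
  rw [partialD_inducedMetric hΦ, partialD_inducedMetric hΦ, partialD_inducedMetric hΦ,
    partialD_partialD_comm hΦ j i, partialD_partialD_comm hΦ l i, partialD_partialD_comm hΦ l j,
    real_inner_comm (partialD l Φ x) (partialD i (fun y => partialD j Φ y) x),
    real_inner_comm (partialD j Φ x) (partialD i (fun y => partialD l Φ y) x)]
  ring

theorem partialD_comp {Φ : EuclideanSpace ℝ (Fin d) → E} {f : E → ℝ}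
    {x : EuclideanSpace ℝ (Fin d)} (hΦ : ContDiffAt ℝ ∞ Φ x) (hf : ContDiff ℝ ∞ f) (i : Fin d) :
    partialD i (fun y => f (Φ y)) x = fderiv ℝ f (Φ x) (partialD i Φ x) := by
  have h1 : HasFDerivAt f (fderiv ℝ f (Φ x)) (Φ x) :=
    (hf.differentiable (by simp)).differentiableAt.hasFDerivAt
  have h2 : HasFDerivAt Φ (fderiv ℝ Φ x) x := (hΦ.differentiableAt (by simp)).hasFDerivAt
  have := (h1.comp x h2).fderiv
  rw [partialD]
  change fderiv ℝ (f ∘ Φ) x _ = _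
  rw [this]
  rfl

theorem partialD_partialD_comp {Φ : EuclideanSpace ℝ (Fin d) → E} {f : E → ℝ}
    {x : EuclideanSpace ℝ (Fin d)} (hΦ : ContDiffAt ℝ ∞ Φ x) (hf : ContDiff ℝ ∞ f)
    (hev : ∀ᶠ y in nhds x, ContDiffAt ℝ ∞ Φ y) (i j : Fin d) :
    partialD i (fun y => partialD j (fun z => f (Φ z)) y) x =
      fderiv ℝ (fderiv ℝ f) (Φ x) (partialD i Φ x) (partialD j Φ x)
        + fderiv ℝ f (Φ x) (partialD i (fun y => partialD j Φ y) x) := by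
  have he : (fun y => partialD j (fun z => f (Φ z)) y) =ᶠ[nhds x]
      fun y => fderiv ℝ f (Φ y) (partialD j Φ y) :=
    hev.mono fun y hy => partialD_comp hy hf j
  have h1 : HasFDerivAt (fderiv ℝ f) (fderiv ℝ (fderiv ℝ f) (Φ x)) (Φ x) :=
    (((hf.fderiv_right (m := 1) (by norm_cast)).differentiable one_ne_zero)).differentiableAt.hasFDerivAt
  have h2 : HasFDerivAt Φ (fderiv ℝ Φ x) x := (hΦ.differentiableAt (by simp)).hasFDerivAt
  have hj := hasFDerivAt_partialD hΦ j
  have := ((h1.comp x h2).clm_apply hj).fderiv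
  conv_lhs => rw [partialD, he.fderiv_eq]
  change fderiv ℝ (fun y => (fderiv ℝ f ∘ Φ) y (partialD j Φ y)) x _ = _
  rw [this]
  conv_rhs => rw [partialD.eq_1 i (fun y => partialD j Φ y), hj.fderiv]
  simp [partialD, add_comm]

/-- The Laplace-Beltrami operator of the induced metric through the orthogonal projection `P` onto
the tangent space (spanned by the partial derivatives of the parametrization). -/
theorem chartLaplaceBeltrami_comp {Φ : EuclideanSpace ℝ (Fin d) → E} {f : E → ℝ}
    {x : EuclideanSpace ℝ (Fin d)} (hf : ContDiff ℝ ∞ f)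
    (hev : ∀ᶠ y in nhds x, ContDiffAt ℝ ∞ Φ y) {P : E → E}
    (hP : ∀ z, ∑ i, ∑ l, ((Matrix.gram ℝ fun i => partialD i Φ x)⁻¹ i l *
      inner ℝ (partialD l Φ x) z) • partialD i Φ x = P z) :
    chartLaplaceBeltrami (inducedMetric Φ) (fun y => f (Φ y)) x =
      ∑ i, ∑ j, (Matrix.gram ℝ fun i => partialD i Φ x)⁻¹ i j *
        (fderiv ℝ (fderiv ℝ f) (Φ x) (partialD i Φ x) (partialD j Φ x)
          + fderiv ℝ f (Φ x) (partialD i (fun y => partialD j Φ y) x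
              - P (partialD i (fun y => partialD j Φ y) x))) := by
  have hΦ := hev.self_of_nhds
  have hg : inducedMetric Φ x = Matrix.gram ℝ fun i => partialD i Φ x := rfl
  have hH : ∀ i j, riemannianHessian (inducedMetric Φ) (fun y => f (Φ y)) x i j =
      fderiv ℝ (fderiv ℝ f) (Φ x) (partialD i Φ x) (partialD j Φ x)
          + fderiv ℝ f (Φ x) (partialD i (fun y => partialD j Φ y) x
              - P (partialD i (fun y => partialD j Φ y) x)) := by
    intro i j
    rw [riemannianHessian, Matrix.of_apply, partialD_partialD_comp hΦ hf hev, map_sub, ← hP,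
      add_sub_assoc, map_sum]
    congr 2
    refine Finset.sum_congr rfl fun k _ => ?_
    rw [christoffel_inducedMetric hΦ, partialD_comp hΦ hf, map_sum, Finset.sum_mul, hg]
    refine Finset.sum_congr rfl fun l _ => ?_
    rw [map_smul, smul_eq_mul]
  rw [chartLaplaceBeltrami, hg, Matrix.trace]
  conv_lhs => rw [← gram_inv_isSymm]
  simp_rw [Matrix.diag_apply, Matrix.mul_apply, Matrix.transpose_apply, hH]
  rw [Finset.sum_comm]

end ChartHessian

/-! ### Tangent vectors and existence of local parametrizations -/

section Parametrization

open Topology Filter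

variable {E : Type*} [NormedAddCommGroup E] [InnerProductSpace ℝ E]

theorem IsLocalParametrization.contDiffAt {S : Set E} {d : ℕ}
    {φ : OpenPartialHomeomorph (EuclideanSpace ℝ (Fin d)) S} (hφ : IsLocalParametrization S φ)
    {x : EuclideanSpace ℝ (Fin d)} (hx : x ∈ φ.source) :
    ContDiffAt ℝ ∞ (fun y => (φ y : E)) x :=
  hφ.smooth.contDiffAt (φ.open_source.mem_nhds hx)

/-- Every velocity of a curve in `S` is in the range of the differential of a parametrization. -/
theorem IsLocalParametrization.tangentVectors_subset_range {S : Set E} {d : ℕ}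
    {φ : OpenPartialHomeomorph (EuclideanSpace ℝ (Fin d)) S} (hφ : IsLocalParametrization S φ)
    {u : S} (hu : u ∈ φ.target) :
    tangentVectors S (u : E) ⊆ Set.range (fderiv ℝ (fun y => (φ y : E)) (φ.symm u)) := by
  rintro v ⟨ε, γ, hε, hγ, hS, h0, rfl⟩
  set x := φ.symm u with hx
  have hxs : x ∈ φ.source := φ.map_target hu
  set D := fderiv ℝ (fun y => (φ y : E)) x with hD
  have hΦ : HasFDerivAt (fun y => (φ y : E)) D x :=
    ((hφ.contDiffAt hxs).differentiableAt (by simp)).hasFDerivAt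
  have hI : Set.Ioo (-ε) ε ∈ 𝓝 (0 : ℝ) := Ioo_mem_nhds (by linarith) hε
  have hγ' : HasDerivAt γ (deriv γ 0) 0 :=
    ((hγ.contDiffAt hI).differentiableAt (by simp)).hasDerivAt
  -- `φ.symm` is only known to be continuous, so the coordinate curve `c` below cannot be
  -- differentiated directly. The lower bound on `D` yields `c t - x = O(t)` instead.
  obtain ⟨K, hK, hKD⟩ := D.toLinearMap.exists_antilipschitzWith
    (LinearMap.ker_eq_bot.2 (hφ.immersive x hxs))
  classical
  set δ : ℝ → S := fun t => if h : γ t ∈ S then ⟨γ t, h⟩ else u with hδ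
  have hδγ : ∀ᶠ t in 𝓝 (0 : ℝ), (δ t : E) = γ t := by
    filter_upwards [hI] with t ht
    simp [hδ, hS t ht]
  have hδ0 : δ 0 = u := Subtype.ext (by rw [hδγ.self_of_nhds, h0])
  have hδc : ContinuousAt δ 0 := by
    rw [Topology.IsInducing.subtypeVal.continuousAt_iff]
    exact hγ'.continuousAt.congr (hδγ.mono fun t ht => ht.symm)
  set c : ℝ → EuclideanSpace ℝ (Fin d) := fun t => φ.symm (δ t) with hc
  have hc0 : c 0 = x := by rw [hc]; simp only [hδ0]; rfl
  have hcc : Tendsto c (𝓝 0) (𝓝 x) := by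
    have : ContinuousAt φ.symm (δ 0) := by rw [hδ0]; exact φ.symm.continuousAt hu
    have := ContinuousAt.comp (f := δ) (g := φ.symm) this hδc
    rw [← hc0]; exact this
  have hφc : ∀ᶠ t in 𝓝 (0 : ℝ), (φ (c t) : E) = γ t := by
    have : ∀ᶠ t in 𝓝 (0 : ℝ), δ t ∈ φ.target :=
      hδc.eventually_mem (by rw [hδ0]; exact φ.open_target.mem_nhds hu)
    filter_upwards [this, hδγ] with t h1 h2
    rw [hc, ← h2]; beta_reduce; rw [φ.right_inv h1]
  have hlittle : (fun t => γ t - γ 0 - D (c t - x)) =o[𝓝 0] fun t => c t - x := by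
    have := hΦ.isLittleO.comp_tendsto hcc
    refine this.congr' ?_ .rfl
    filter_upwards [hφc] with t ht
    simp [Function.comp, ht, h0, hx, φ.right_inv hu]
  have hbig1 : (fun t => c t - x) =O[𝓝 0] fun t => D (c t - x) := by
    refine Asymptotics.IsBigO.of_bound K (Eventually.of_forall fun t => ?_)
    simpa [norm_sub_rev x, norm_sub_rev (D x)] using hKD.le_mul_norm_sub (x := c t - x) (y := 0)
  have hbig2 : (fun t => D (c t - x)) =O[𝓝 0] fun t => γ t - γ 0 := by
    have h1 := hlittle.trans_isBigO hbig1
    simpa using h1.right_isBigO_add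
  have hbig3 : (fun t => γ t - γ 0) =O[𝓝 0] fun t => t - 0 := hγ'.hasFDerivAt.isBigO_sub
  -- The remainder is `o(t)`, so the velocity is a limit of points of the range of `D`, which is
  -- closed by finite dimension.
  have hlim : Tendsto (fun t => D (t⁻¹ • (c t - x))) (𝓝[≠] 0) (𝓝 (deriv γ 0)) := by
    have h1 : (fun t => γ t - γ 0 - D (c t - x)) =o[𝓝[≠] 0] fun t => t :=
      ((hlittle.trans_isBigO ((hbig1.trans hbig2).trans hbig3)).mono nhdsWithin_le_nhds).congr_right
        (by simp)
    have h2 : Tendsto (fun t => t⁻¹ • (γ t - γ 0)) (𝓝[≠] 0) (𝓝 (deriv γ 0)) := by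
      simpa using hγ'.tendsto_slope_zero
    have h3 : Tendsto (fun t => t⁻¹ • (γ t - γ 0 - D (c t - x))) (𝓝[≠] 0) (𝓝 0) :=
      h1.tendsto_inv_smul_nhds_zero
    have := h2.sub h3
    simp only [sub_zero] at this
    refine this.congr fun t => ?_
    rw [map_smul, ← smul_sub]
    congr 1
    abel
  have hclosed : IsClosed (Set.range D) := by
    have : FiniteDimensional ℝ (LinearMap.range D.toLinearMap) := inferInstance
    exact (LinearMap.range D.toLinearMap).closed_of_finiteDimensional
  exact hclosed.mem_of_tendsto hlim (Eventually.of_forall fun t => ⟨_, rfl⟩)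

/-- If a smooth map `G`, invertible to first order at `u`, straightens `S` to a linear subspace,
then `S` has a smooth local parametrization around `u`. -/
theorem exists_isLocalParametrization [FiniteDimensional ℝ E] {S : Set E} (T : Submodule ℝ E)
    {G : E → E} (hG : ContDiff ℝ ∞ G) (hS : ∀ X, X ∈ S ↔ G X ∈ T) (u : S)
    (hu : Function.Injective (fderiv ℝ G u)) :
    ∃ (d : ℕ) (φ : OpenPartialHomeomorph (EuclideanSpace ℝ (Fin d)) S),
      IsLocalParametrization S φ ∧ u ∈ φ.target := by
  have hdiff : ∀ X, HasFDerivAt G (fderiv ℝ G X) X := fun X =>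
    (hG.differentiable (by simp)).differentiableAt.hasFDerivAt
  obtain ⟨G', hG'⟩ : ∃ G' : E ≃L[ℝ] E, (G' : E →L[ℝ] E) = fderiv ℝ G u :=
    ⟨(LinearEquiv.ofInjectiveEndo (fderiv ℝ G u : E →ₗ[ℝ] E) hu).toContinuousLinearEquiv,
      by ext; rfl⟩
  let Q₀ := hG.contDiffAt.toOpenPartialHomeomorph G (hG' ▸ hdiff u) (by simp)
  have hQ₀ : (Q₀ : E → E) = G := ContDiffAt.toOpenPartialHomeomorph_coe _ _ _
  have hu₀ : (u : E) ∈ Q₀.source := ContDiffAt.mem_toOpenPartialHomeomorph_source _ _ _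
  -- Shrinking to points with invertible derivative makes the local inverse smooth on its whole
  -- domain, not only at `G u`.
  have hO : IsOpen (fderiv ℝ G ⁻¹' Set.range (ContinuousLinearEquiv.toContinuousLinearMap : (E ≃L[ℝ] E) → _)) :=
    ContinuousLinearEquiv.isOpen.preimage (hG.continuous_fderiv (by simp))
  let Q := Q₀.restrOpen _ hO
  have hQ : (Q : E → E) = G := hQ₀
  have huQ : (u : E) ∈ Q.source := ⟨hu₀, G', hG'⟩
  have hequiv : ∀ X ∈ Q.source, ∃ A : E ≃L[ℝ] E, (A : E →L[ℝ] E) = fderiv ℝ G X := fun X hX => hX.2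
  let ι : EuclideanSpace ℝ (Fin (Module.finrank ℝ T)) ≃L[ℝ] T :=
    (stdOrthonormalBasis ℝ T).repr.symm.toContinuousLinearEquiv
  let s : Set (EuclideanSpace ℝ (Fin (Module.finrank ℝ T))) := {x | (ι x : E) ∈ Q.target}
  have hι : Continuous fun x => (ι x : E) := continuous_subtype_val.comp ι.continuous
  have hs : IsOpen s := Q.open_target.preimage hι
  have hmem : ∀ x ∈ s, Q.symm (ι x) ∈ S := fun x hx => by
    rw [hS, ← hQ, Q.right_inv hx]; exact (ι x).2
  classical
  have hsymm : ∀ z ∈ Q.target, ContDiffAt ℝ ∞ Q.symm z := fun z hz => by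
    obtain ⟨A, hA⟩ := hequiv _ (Q.map_target hz)
    exact Q.contDiffAt_symm (f₀' := A) hz (by rw [hQ, hA]; exact hdiff _)
      (by rw [hQ]; exact hG.contDiffAt)
  let φ : OpenPartialHomeomorph (EuclideanSpace ℝ (Fin (Module.finrank ℝ T))) S :=
    { toFun := fun x => if h : x ∈ s then ⟨Q.symm (ι x), hmem x h⟩ else u
      invFun := fun X => ι.symm ⟨G X, (hS X).1 X.2⟩
      source := s
      target := {X | (X : E) ∈ Q.source}
      map_source' := fun x hx => by
        simp only [hx, dite_true]
        exact Q.map_target hx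
      map_target' := fun X hX => by
        change ((ι (ι.symm _) : T) : E) ∈ Q.target
        rw [ι.apply_symm_apply]
        simpa only [hQ] using Q.map_source hX
      left_inv' := fun x hx => by
        simp only [hx, dite_true]
        rw [ι.symm_apply_eq]
        ext
        simp only
        rw [← hQ, Q.right_inv hx]
      right_inv' := fun X hX => by
        have h : (ι (ι.symm ⟨G X, (hS X).1 X.2⟩) : E) = Q X := by
          rw [ι.apply_symm_apply, hQ]
        have h' : ι.symm ⟨G X, (hS X).1 X.2⟩ ∈ s := by
          change (ι _ : E) ∈ Q.target
          rw [h]; exact Q.map_source hX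
        rw [dif_pos h']
        ext
        simp only
        rw [h, Q.left_inv hX]
      continuousOn_toFun := by
        rw [Topology.IsInducing.subtypeVal.continuousOn_iff]
        refine (Q.symm.continuousOn.comp hι.continuousOn fun x hx => hx).congr fun x hx => ?_
        have hx' : x ∈ s := hx
        simp [Function.comp, hx']
      continuousOn_invFun :=
        (ι.symm.continuous.comp ((hG.continuous.comp continuous_subtype_val).subtype_mk _)).continuousOn
      open_source := hs
      open_target := Q.open_source.preimage continuous_subtype_val }
  have hφ : ∀ x ∈ s, (φ x : E) = Q.symm (ι x) := fun x hx => by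
    change ((if h : x ∈ s then (⟨Q.symm (ι x), hmem x h⟩ : S) else u : S) : E) = _
    rw [dif_pos hx]
  have hιs : ContDiff ℝ ∞ fun x => (ι x : E) := (T.subtypeL.comp ι.toContinuousLinearMap).contDiff
  have hsm : ∀ x ∈ s, ContDiffAt ℝ ∞ (fun y => (φ y : E)) x := fun x hx =>
    ((hsymm _ hx).comp x hιs.contDiffAt).congr_of_eventuallyEq
      (Filter.eventuallyEq_of_mem (hs.mem_nhds hx) hφ)
  refine ⟨_, φ, ⟨fun x hx => (hsm x hx).contDiffWithinAt, fun x hx => ?_⟩, huQ⟩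
  have h1 : (fun y => G (φ y)) =ᶠ[𝓝 x] fun y => (ι y : E) := by
    filter_upwards [hs.mem_nhds hx] with y hy
    rw [hφ y hy, ← hQ, Q.right_inv hy]
  have h2 : HasFDerivAt (fun y => G (φ y))
      ((fderiv ℝ G (φ x)).comp (fderiv ℝ (fun y => (φ y : E)) x)) x :=
    (hdiff (φ x)).comp x ((hsm x hx).differentiableAt (by simp)).hasFDerivAt
  have h3 : HasFDerivAt (fun y => (ι y : E)) (T.subtypeL.comp ι.toContinuousLinearMap) x :=
    (T.subtypeL.comp ι.toContinuousLinearMap).hasFDerivAt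
  -- By the chain rule `DG ∘ Dφ` is the injective linear map `ι` followed by inclusion, so `Dφ` is
  -- injective.
  have h4 := h2.unique (h3.congr_of_eventuallyEq h1)
  refine Function.Injective.of_comp (f := fderiv ℝ G (φ x)) ?_
  rw [← ContinuousLinearMap.coe_comp, h4]
  exact Subtype.val_injective.comp ι.injective

end Parametrization

/-! ### Tangent space, projection and charts of the Stiefel manifold -/

section StiefelTangent

variable {n p : ℕ}

theorem frobenius_inner_def (A B : Matrix (Fin n) (Fin p) ℝ) :
    inner ℝ A B = Matrix.trace (Aᵀ * B) := rfl

/-- The symmetrized product `Uᵀ Z + Zᵀ U`, as a linear map in `Z`. -/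
def symPart (U : Matrix (Fin n) (Fin p) ℝ) :
    Matrix (Fin n) (Fin p) ℝ →ₗ[ℝ] Matrix (Fin p) (Fin p) ℝ where
  toFun Z := Uᵀ * Z + Zᵀ * U
  map_add' X Y := by simp only [Matrix.mul_add, Matrix.transpose_add, Matrix.add_mul]; abel
  map_smul' c X := by simp

theorem symPart_apply (U Z : Matrix (Fin n) (Fin p) ℝ) : symPart U Z = Uᵀ * Z + Zᵀ * U := rfl

theorem symPart_transpose (U Z : Matrix (Fin n) (Fin p) ℝ) : (symPart U Z)ᵀ = symPart U Z := by
  simp [symPart_apply, add_comm]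

theorem symPart_mul {U : Matrix (Fin n) (Fin p) ℝ} (hU : U ∈ stiefel n p)
    {S : Matrix (Fin p) (Fin p) ℝ} (hS : Sᵀ = S) : symPart U (U * S) = (2 : ℝ) • S := by
  have hU' : Uᵀ * U = 1 := hU
  rw [symPart_apply, ← Matrix.mul_assoc, Matrix.transpose_mul, Matrix.mul_assoc Sᵀ, hU', hS,
    two_smul, Matrix.one_mul, Matrix.mul_one]

/-- The orthogonal projection onto the tangent space of the Stiefel manifold at `U`. -/
def stiefelProj (U : Matrix (Fin n) (Fin p) ℝ) :
    Matrix (Fin n) (Fin p) ℝ →ₗ[ℝ] Matrix (Fin n) (Fin p) ℝ where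
  toFun Z := Z - (1 / 2 : ℝ) • (U * symPart U Z)
  map_add' X Y := by
    simp only [map_add, Matrix.mul_add, smul_add]; abel
  map_smul' c X := by
    simp only [map_smul, Matrix.mul_smul, smul_sub, RingHom.id_apply, smul_comm c]

theorem stiefelProj_apply (U Z : Matrix (Fin n) (Fin p) ℝ) :
    stiefelProj U Z = Z - (1 / 2 : ℝ) • (U * symPart U Z) := rfl

theorem symPart_stiefelProj {U : Matrix (Fin n) (Fin p) ℝ} (hU : U ∈ stiefel n p)
    (Z : Matrix (Fin n) (Fin p) ℝ) : symPart U (stiefelProj U Z) = 0 := by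
  rw [stiefelProj_apply, map_sub, map_smul, symPart_mul hU (symPart_transpose U Z), smul_smul]
  norm_num

/-- The difference is `½ U S` with `S` symmetric, while `Wᵀ U` is skew; the trace of a skew matrix
times a symmetric one vanishes. -/
theorem inner_sub_stiefelProj {U W : Matrix (Fin n) (Fin p) ℝ} (hW : symPart U W = 0)
    (Z : Matrix (Fin n) (Fin p) ℝ) : inner ℝ W (Z - stiefelProj U Z) = 0 := by
  have h1 : Wᵀ * U = -(Uᵀ * W) := by
    rw [eq_neg_iff_add_eq_zero, add_comm, ← symPart_apply, hW]
  have h2 : Matrix.trace (Wᵀ * U * symPart U Z) = -Matrix.trace (Wᵀ * U * symPart U Z) := by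
    conv_lhs => rw [← Matrix.trace_transpose, Matrix.transpose_mul, symPart_transpose,
      Matrix.trace_mul_comm, Matrix.transpose_mul, Matrix.transpose_transpose]
    rw [h1, Matrix.neg_mul, Matrix.trace_neg, neg_neg]
  rw [stiefelProj_apply, sub_sub_cancel, inner_smul_right, frobenius_inner_def, ← Matrix.mul_assoc]
  linarith

/-- The product `Xᵀ Y` as a continuous bilinear map. -/
def transposeMul (n p : ℕ) :
    Matrix (Fin n) (Fin p) ℝ →L[ℝ] Matrix (Fin n) (Fin p) ℝ →L[ℝ] Matrix (Fin p) (Fin p) ℝ :=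
  (LinearMap.mk₂ ℝ (fun X Y : Matrix (Fin n) (Fin p) ℝ => Xᵀ * Y)
    (by simp [Matrix.add_mul]) (by simp) (by simp [Matrix.mul_add])
    (by simp)).toContinuousBilinearMap

theorem hasFDerivAt_transpose_mul {H : Type*} [NormedAddCommGroup H] [NormedSpace ℝ H]
    {A B : H → Matrix (Fin n) (Fin p) ℝ} {A' B' : H →L[ℝ] Matrix (Fin n) (Fin p) ℝ} {x : H}
    (hA : HasFDerivAt A A' x) (hB : HasFDerivAt B B' x) :
    ∃ L : H →L[ℝ] Matrix (Fin p) (Fin p) ℝ, HasFDerivAt (fun y => (A y)ᵀ * B y) L x ∧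
      ∀ h, L h = (A x)ᵀ * B' h + (A' h)ᵀ * B x :=
  ⟨_, (transposeMul n p).hasFDerivAt_of_bilinear hA hB, fun _ => rfl⟩

/-- One inclusion differentiates `γᵀ γ = 1`. For the other, the curve `exp(tA) U` with `A` skew
stays in the manifold, and its velocity at `0` is `A U`. -/
theorem tangentVectors_stiefel {U : Matrix (Fin n) (Fin p) ℝ} (hU : U ∈ stiefel n p) :
    tangentVectors (stiefel n p) U = {Z | symPart U Z = 0} := by
  ext Z
  constructor
  · rintro ⟨ε, γ, hε, hγ, hS, rfl, rfl⟩
    have hI : Set.Ioo (-ε) ε ∈ nhds (0 : ℝ) := Ioo_mem_nhds (by linarith) hε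
    have hγ' : HasFDerivAt γ (fderiv ℝ γ 0) 0 :=
      ((hγ.contDiffAt hI).differentiableAt (by simp)).hasFDerivAt
    have h1 : (fun t => (γ t)ᵀ * γ t) =ᶠ[nhds 0] fun _ => 1 := by
      filter_upwards [hI] with t ht
      exact hS t ht
    obtain ⟨L, hL, hL'⟩ := hasFDerivAt_transpose_mul hγ' hγ'
    have h2 : L = 0 := hL.unique ((hasFDerivAt_const 1 (0 : ℝ)).congr_of_eventuallyEq h1)
    have h3 := hL' 1
    rw [h2] at h3
    exact h3.symm
  · intro hZ
    have hZ' : Uᵀ * Z = -(Zᵀ * U) := by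
      rw [eq_neg_iff_add_eq_zero]; exact hZ
    have hU' : Uᵀ * U = 1 := hU
    -- The first two terms form a skew matrix sending `U` to `Z - U Zᵀ U`; the third, skew because
    -- `Zᵀ U` is, restores `U Zᵀ U`.
    set A : Matrix (Fin n) (Fin n) ℝ := Z * Uᵀ - U * Zᵀ + U * (Zᵀ * U) * Uᵀ with hA
    have hAU : A * U = Z := by
      rw [hA, Matrix.add_mul, Matrix.sub_mul, Matrix.mul_assoc Z, Matrix.mul_assoc _ Uᵀ, hU',
        Matrix.mul_assoc U Zᵀ]
      simp
    have hskew : Aᵀ = -A := by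
      have h3 : (Zᵀ * U)ᵀ = -(Zᵀ * U) := by
        rw [Matrix.transpose_mul, Matrix.transpose_transpose, hZ']
      rw [hA, Matrix.transpose_add, Matrix.transpose_sub, Matrix.transpose_mul (U * _), Matrix.transpose_mul U (Zᵀ * U), h3]
      simp [Matrix.mul_assoc]
      abel
    have hder : ∀ t : ℝ, HasDerivAt (fun u : ℝ => NormedSpace.exp (u • A))
        (NormedSpace.exp (t • A) * A) t := hasDerivAt_exp_smul_const A
    let R : Matrix (Fin n) (Fin n) ℝ →L[ℝ] Matrix (Fin n) (Fin p) ℝ :=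
      LinearMap.toContinuousLinearMap
        { toFun := fun X => X * U
          map_add' := fun X Y => Matrix.add_mul X Y U
          map_smul' := fun c X => by simp }
    have hsm : ContDiff ℝ ∞ fun u : ℝ => NormedSpace.exp (u • A) := by
      have : ContDiff ℝ ∞ (NormedSpace.exp : Matrix (Fin n) (Fin n) ℝ → _) :=
        contDiff_iff_contDiffAt.2 fun X => (NormedSpace.exp_analytic (𝕂 := ℝ) X).contDiffAt
      exact this.comp (contDiff_id.smul contDiff_const)
    refine ⟨1, fun t => R (NormedSpace.exp (t • A)), one_pos, (R.contDiff.comp hsm).contDiffOn,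
      fun t _ => ?_, ?_, ?_⟩
    · change (NormedSpace.exp (t • A) * U)ᵀ * (NormedSpace.exp (t • A) * U) = 1
      have h4 : (NormedSpace.exp (t • A))ᵀ * NormedSpace.exp (t • A) = 1 := by
        rw [← Matrix.exp_transpose, Matrix.transpose_smul, hskew, ← Matrix.exp_add_of_commute]
        · simp
        · exact (Commute.refl A).neg_left.smul_left t |>.smul_right t
      rw [Matrix.transpose_mul, Matrix.mul_assoc, ← Matrix.mul_assoc _ _ U, h4, Matrix.one_mul, hU']
    · change NormedSpace.exp ((0 : ℝ) • A) * U = U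
      simp
    · have h5 : HasDerivAt (fun t : ℝ => R (NormedSpace.exp (t • A)))
          (R (NormedSpace.exp ((0 : ℝ) • A) * A)) 0 := R.hasFDerivAt.comp_hasDerivAt 0 (hder 0)
      rw [h5.deriv]
      change NormedSpace.exp ((0 : ℝ) • A) * A * U = Z
      simp [hAU]

theorem exists_isLocalParametrization_stiefel (U : stiefel n p) :
    ∃ (d : ℕ) (φ : OpenPartialHomeomorph (EuclideanSpace ℝ (Fin d)) (stiefel n p)),
      IsLocalParametrization (stiefel n p) φ ∧ U ∈ φ.target := by
  obtain ⟨U, hU⟩ := U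
  let P : Matrix (Fin n) (Fin p) ℝ →L[ℝ] Matrix (Fin n) (Fin p) ℝ :=
    (stiefelProj U).toContinuousLinearMap
  let R : Matrix (Fin p) (Fin p) ℝ →L[ℝ] Matrix (Fin n) (Fin p) ℝ :=
    LinearMap.toContinuousLinearMap
      { toFun := fun X => U * X
        map_add' := fun X Y => Matrix.mul_add U X Y
        map_smul' := fun c X => by simp }
  -- The tangential part of `G X` is that of `X`, and its normal part is `U` times the defect of the
  -- constraint. Hence `symPart U (G X) = 2 (Xᵀ X - 1)`, which vanishes exactly on the manifold.
  let G : Matrix (Fin n) (Fin p) ℝ → Matrix (Fin n) (Fin p) ℝ :=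
    fun X => P X + R (Xᵀ * X - 1)
  have hQ : ContDiff ℝ ∞ fun X : Matrix (Fin n) (Fin p) ℝ => Xᵀ * X :=
    (transposeMul n p).isBoundedBilinearMap.contDiff.comp (contDiff_id.prodMk contDiff_id)
  have hG : ContDiff ℝ ∞ G := P.contDiff.add (R.contDiff.comp (hQ.sub contDiff_const))
  have hsymm : ∀ X : Matrix (Fin n) (Fin p) ℝ, (Xᵀ * X - 1)ᵀ = Xᵀ * X - 1 := fun X => by simp
  refine exists_isLocalParametrization (LinearMap.ker (symPart U)) hG (fun X => ?_) ⟨U, hU⟩ ?_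
  · change _ ↔ symPart U (stiefelProj U X + U * (Xᵀ * X - 1)) = 0
    rw [map_add, symPart_stiefelProj hU, symPart_mul hU (hsymm X), zero_add]
    simp [stiefel, sub_eq_zero]
  · obtain ⟨L, hL, hL'⟩ := hasFDerivAt_transpose_mul (hasFDerivAt_id U) (hasFDerivAt_id U)
    have hd : HasFDerivAt G _ U :=
      P.hasFDerivAt.add (R.hasFDerivAt.comp U (hL.sub_const 1))
    have hd' : ∀ Z, fderiv ℝ G U Z = stiefelProj U Z + U * symPart U Z := fun Z => by
      rw [hd.fderiv]
      exact congrArg (fun Y => stiefelProj U Z + U * Y) (hL' Z)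
    refine (injective_iff_map_eq_zero (fderiv ℝ G U)).2 fun Z hZ => ?_
    have hZ' : stiefelProj U Z + U * symPart U Z = 0 := (hd' Z).symm.trans hZ
    have h1 : symPart U Z = 0 := by
      have := congrArg (symPart U) hZ'
      rw [map_add, symPart_stiefelProj hU, symPart_mul hU (symPart_transpose U Z), map_zero] at this
      simpa using this
    simpa [stiefelProj_apply, h1] using hZ'

end StiefelTangent

/-! ### Second fundamental form and sums over matrix units -/

section StiefelTrace

variable {n p : ℕ}

theorem partialD_transpose_mul {d : ℕ}
    {A B : EuclideanSpace ℝ (Fin d) → Matrix (Fin n) (Fin p) ℝ} {x : EuclideanSpace ℝ (Fin d)}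
    (hA : DifferentiableAt ℝ A x) (hB : DifferentiableAt ℝ B x) (i : Fin d) :
    partialD i (fun y => (A y)ᵀ * B y) x =
      (A x)ᵀ * partialD i B x + (partialD i A x)ᵀ * B x := by
  obtain ⟨L, hL, hL'⟩ := hasFDerivAt_transpose_mul hA.hasFDerivAt hB.hasFDerivAt
  exact (congrArg (fun L => L (EuclideanSpace.single i 1)) hL.fderiv).trans (hL' _)

theorem symPart_partialD {d : ℕ} {Φ : EuclideanSpace ℝ (Fin d) → Matrix (Fin n) (Fin p) ℝ}
    {x : EuclideanSpace ℝ (Fin d)} (hΦ : ContDiffAt ℝ ∞ Φ x)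
    (hS : ∀ᶠ y in nhds x, Φ y ∈ stiefel n p) (i : Fin d) :
    symPart (Φ x) (partialD i Φ x) = 0 := by
  have h1 : DifferentiableAt ℝ Φ x := hΦ.differentiableAt (by simp)
  have hc : (fun y => (Φ y)ᵀ * Φ y) =ᶠ[nhds x] fun _ => 1 := hS.mono fun y hy => hy
  have h0 : HasFDerivAt (fun y => (Φ y)ᵀ * Φ y)
      (0 : EuclideanSpace ℝ (Fin d) →L[ℝ] Matrix (Fin p) (Fin p) ℝ) x :=
    (hasFDerivAt_const 1 x).congr_of_eventuallyEq hc
  rw [symPart_apply, ← partialD_transpose_mul h1 h1]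
  exact congrArg (fun L => L (EuclideanSpace.single i 1)) h0.fderiv

/-- The second fundamental form of the Stiefel manifold in a parametrization. -/
theorem partialD_partialD_sub_stiefelProj {d : ℕ}
    {Φ : EuclideanSpace ℝ (Fin d) → Matrix (Fin n) (Fin p) ℝ} {x : EuclideanSpace ℝ (Fin d)}
    (hev : ∀ᶠ y in nhds x, ContDiffAt ℝ ∞ Φ y) (hS : ∀ᶠ y in nhds x, Φ y ∈ stiefel n p)
    (i j : Fin d) :
    partialD i (fun y => partialD j Φ y) x
        - stiefelProj (Φ x) (partialD i (fun y => partialD j Φ y) x) =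
      -((1 / 2 : ℝ) • (Φ x * ((partialD i Φ x)ᵀ * partialD j Φ x
        + (partialD j Φ x)ᵀ * partialD i Φ x))) := by
  have hΦ := hev.self_of_nhds
  have h1 : DifferentiableAt ℝ Φ x := hΦ.differentiableAt (by simp)
  have hj := (hasFDerivAt_partialD hΦ j).differentiableAt
  obtain ⟨L, hL, hL'⟩ := hasFDerivAt_transpose_mul h1.hasFDerivAt hj.hasFDerivAt
  obtain ⟨M, hM, hM'⟩ := hasFDerivAt_transpose_mul hj.hasFDerivAt h1.hasFDerivAt
  have hc : (fun y => (Φ y)ᵀ * partialD j Φ y + (partialD j Φ y)ᵀ * Φ y) =ᶠ[nhds x]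
      fun _ => 0 := by
    filter_upwards [hev, hS.eventually_nhds] with y hy hy'
    exact symPart_partialD hy hy' j
  have h0 : L + M = 0 :=
    (hL.add hM).unique ((hasFDerivAt_const 0 x).congr_of_eventuallyEq hc)
  have h2 : L (EuclideanSpace.single i 1) + M (EuclideanSpace.single i 1) = 0 :=
    congrArg (fun A => A (EuclideanSpace.single i 1)) h0
  have h4 : L (EuclideanSpace.single i 1) = (Φ x)ᵀ * partialD i (fun y => partialD j Φ y) x
      + (partialD i Φ x)ᵀ * partialD j Φ x := hL' _
  have h5 : M (EuclideanSpace.single i 1) = (partialD j Φ x)ᵀ * partialD i Φ x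
      + (partialD i (fun y => partialD j Φ y) x)ᵀ * Φ x := hM' _
  have h3 : symPart (Φ x) (partialD i (fun y => partialD j Φ y) x) =
      -((partialD i Φ x)ᵀ * partialD j Φ x + (partialD j Φ x)ᵀ * partialD i Φ x) := by
    rw [eq_neg_iff_add_eq_zero, ← h2, symPart_apply, h4, h5]
    abel
  rw [stiefelProj_apply, sub_sub_cancel, h3, Matrix.mul_neg, smul_neg]

/-- The matrix units form an orthonormal basis for the Frobenius inner product. -/
def frobeniusBasis (n p : ℕ) :
    OrthonormalBasis (Fin n × Fin p) ℝ (Matrix (Fin n) (Fin p) ℝ) :=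
  (Matrix.stdBasis ℝ (Fin n) (Fin p)).toOrthonormalBasis (by
    rw [orthonormal_iff_ite]
    rintro ⟨a, i⟩ ⟨b, j⟩
    rw [frobenius_inner_def, Matrix.stdBasis_eq_single, Matrix.stdBasis_eq_single,
      Matrix.transpose_single]
    by_cases hab : a = b
    · subst hab
      by_cases hij : i = j
      · subst hij; simp
      · simp [hij, Matrix.trace_single_eq_of_ne _ _ _ hij]
    · simp [hab])

theorem frobeniusBasis_apply (α : Fin n × Fin p) :
    frobeniusBasis n p α = Matrix.single α.1 α.2 1 := by
  rw [frobeniusBasis, Module.Basis.coe_toOrthonormalBasis]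
  exact Matrix.stdBasis_eq_single ..

/-- The matrix `I ⊗ U Uᵀ + Λ(U)` represents `Z ↦ U (Uᵀ Z + Zᵀ U)` in column vectorization. -/
theorem kronecker_add_lambdaMatrix_mulVec (U Z : Matrix (Fin n) (Fin p) ℝ) :
    ((1 : Matrix (Fin p) (Fin p) ℝ) ⊗ₖ (U * Uᵀ) + lambdaMatrix U) *ᵥ Z.vec =
      (U * symPart U Z).vec := by
  have h : lambdaMatrix U *ᵥ Z.vec = (U * (Zᵀ * U)).vec := by
    ext ⟨i, a⟩
    simp only [Matrix.mulVec, dotProduct, lambdaMatrix, Matrix.of_apply, Matrix.vecMulVec_apply,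
      Matrix.col_apply, Matrix.vec, Matrix.mul_apply, Matrix.transpose_apply, Fintype.sum_prod_type,
      Finset.mul_sum]
    exact Finset.sum_congr rfl fun j _ => Finset.sum_congr rfl fun b _ => by ring
  rw [Matrix.add_mulVec, Matrix.kronecker_mulVec_vec, h, ← Matrix.vec_add, symPart_apply,
    Matrix.mul_add]
  simp [Matrix.mul_assoc]

/-- For the unit `E` at position `(b, j)`, `Eᵀ A E` is `A b b` times the diagonal unit at `j`. -/
theorem sum_single_transpose_mul_mul (A : Matrix (Fin n) (Fin n) ℝ) :
    ∑ α : Fin n × Fin p, (Matrix.single α.1 α.2 (1 : ℝ))ᵀ * A * Matrix.single α.1 α.2 (1 : ℝ) =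
      A.trace • (1 : Matrix (Fin p) (Fin p) ℝ) := by
  rw [Fintype.sum_prod_type, Matrix.trace, Finset.sum_smul]
  refine Finset.sum_congr rfl fun b _ => ?_
  have : (1 : Matrix (Fin p) (Fin p) ℝ) = ∑ j, Matrix.single j j 1 := by
    ext i k
    rw [Matrix.sum_apply]
    simp [Matrix.single_apply, Matrix.one_apply, ite_and]
  rw [this, Finset.smul_sum]
  refine Finset.sum_congr rfl fun j _ => ?_
  rw [Matrix.transpose_single]
  simp [Matrix.single_mul_mul_single]

/-- Source of the constant `n - (p + 1) / 2`: the sums of `Eᵀ E`, `Eᵀ U Uᵀ E` and `Eᵀ U Eᵀ U` are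
`n`, `p` and `1` times the identity, with weights `1`, `-½` and `-½`. -/
theorem sum_single_transpose_mul_stiefelProj {U : Matrix (Fin n) (Fin p) ℝ}
    (hU : U ∈ stiefel n p) :
    ∑ α : Fin n × Fin p, (Matrix.single α.1 α.2 (1 : ℝ))ᵀ *
        stiefelProj U (Matrix.single α.1 α.2 (1 : ℝ)) =
      ((n : ℝ) - ((p : ℝ) + 1) / 2) • (1 : Matrix (Fin p) (Fin p) ℝ) := by
  have hU' : Uᵀ * U = 1 := hU
  have h1 : ∑ α : Fin n × Fin p, (Matrix.single α.1 α.2 (1 : ℝ))ᵀ * Matrix.single α.1 α.2 (1 : ℝ) =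
      (n : ℝ) • (1 : Matrix (Fin p) (Fin p) ℝ) := by
    simpa using sum_single_transpose_mul_mul (p := p) (1 : Matrix (Fin n) (Fin n) ℝ)
  have h2 : ∑ α : Fin n × Fin p, (Matrix.single α.1 α.2 (1 : ℝ))ᵀ * (U * Uᵀ) *
      Matrix.single α.1 α.2 (1 : ℝ) = (p : ℝ) • (1 : Matrix (Fin p) (Fin p) ℝ) := by
    rw [sum_single_transpose_mul_mul, Matrix.trace_mul_comm, hU', Matrix.trace_one, Fintype.card_fin]
  have h3 : ∑ α : Fin n × Fin p, (Matrix.single α.1 α.2 (1 : ℝ))ᵀ * U *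
      ((Matrix.single α.1 α.2 (1 : ℝ))ᵀ * U) = 1 := by
    rw [← hU']
    ext j k
    rw [Matrix.sum_apply, Fintype.sum_prod_type, Matrix.mul_apply]
    refine Finset.sum_congr rfl fun b _ => ?_
    rw [Finset.sum_eq_single j]
    · simp [Matrix.transpose_single, ← Matrix.mul_assoc, Matrix.single_mul_mul_single]
    · intro i _ hi
      simp [Matrix.transpose_single, ← Matrix.mul_assoc, Matrix.single_mul_mul_single, hi.symm]
    · simp
  have h4 : ∀ α : Fin n × Fin p, (Matrix.single α.1 α.2 (1 : ℝ))ᵀ *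
        stiefelProj U (Matrix.single α.1 α.2 (1 : ℝ)) =
      (Matrix.single α.1 α.2 (1 : ℝ))ᵀ * Matrix.single α.1 α.2 (1 : ℝ)
        - (1 / 2 : ℝ) • ((Matrix.single α.1 α.2 (1 : ℝ))ᵀ * (U * Uᵀ) * Matrix.single α.1 α.2 (1 : ℝ))
        - (1 / 2 : ℝ) • ((Matrix.single α.1 α.2 (1 : ℝ))ᵀ * U *
            ((Matrix.single α.1 α.2 (1 : ℝ))ᵀ * U)) := by
    intro α
    rw [stiefelProj_apply, symPart_apply, Matrix.mul_sub, Matrix.mul_smul, Matrix.mul_add,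
      Matrix.mul_add, smul_add, sub_sub]
    simp only [Matrix.mul_assoc]
  rw [Finset.sum_congr rfl fun α _ => h4 α, Finset.sum_sub_distrib, Finset.sum_sub_distrib, ← Finset.smul_sum, ← Finset.smul_sum, h1, h2,
    h3, smul_smul, ← sub_smul, ← sub_smul]
  congr 1
  ring

theorem trace_kronecker_add_lambdaMatrix_mul_hessianMatrix
    (f : Matrix (Fin n) (Fin p) ℝ → ℝ) (U : Matrix (Fin n) (Fin p) ℝ) :
    Matrix.trace (((1 : Matrix (Fin p) (Fin p) ℝ) ⊗ₖ (U * Uᵀ) + lambdaMatrix U)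
        * hessianMatrix f U) =
      ∑ α : Fin n × Fin p, fderiv ℝ (fderiv ℝ f) U
        (U * symPart U (Matrix.single α.1 α.2 (1 : ℝ))) (Matrix.single α.1 α.2 (1 : ℝ)) := by
  set M := (1 : Matrix (Fin p) (Fin p) ℝ) ⊗ₖ (U * Uᵀ) + lambdaMatrix U with hM
  have hMs : ∀ (r : Fin p × Fin n) (α : Fin n × Fin p),
      (U * symPart U (Matrix.single α.1 α.2 (1 : ℝ))) r.2 r.1 = M r (α.2, α.1) := by
    intro r α
    have := congrFun (kronecker_add_lambdaMatrix_mulVec U (Matrix.single α.1 α.2 (1 : ℝ))) r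
    rw [Matrix.vec_single] at this
    rw [Matrix.mulVec_single_one] at this
    exact this.symm
  -- Expanding `U * symPart U E` in units produces a column of `M`, whereas the trace of the product
  -- uses a row; symmetry reconciles them.
  have hMt : ∀ r s, M r s = M s r := by
    rintro ⟨i, a⟩ ⟨j, b⟩
    simp only [hM, Matrix.add_apply, Matrix.kroneckerMap_apply, lambdaMatrix, Matrix.of_apply,
      Matrix.vecMulVec_apply, Matrix.col_apply, Matrix.mul_apply, Matrix.transpose_apply,
      Matrix.one_apply, eq_comm (a := j)]
    rw [mul_comm (U a j)]
    congr 2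
    exact Finset.sum_congr rfl fun _ _ => mul_comm _ _
  rw [Matrix.trace, ← (Equiv.prodComm (Fin n) (Fin p)).sum_comp]
  refine Finset.sum_congr rfl fun α _ => ?_
  rw [Matrix.diag_apply, Matrix.mul_apply]
  conv_rhs => rw [Matrix.matrix_eq_sum_single (U * symPart U (Matrix.single α.1 α.2 (1 : ℝ)))]
  rw [Finset.sum_comm, map_sum, sum_apply, Fintype.sum_prod_type]
  refine Finset.sum_congr rfl fun i _ => ?_
  rw [map_sum, sum_apply]
  refine Finset.sum_congr rfl fun a _ => ?_
  rw [hMs (i, a), hMt (i, a), hessianMatrix, Matrix.of_apply, iteratedFDeriv_two_apply]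
  have : Matrix.single a i (M (α.2, α.1) (i, a)) = M (α.2, α.1) (i, a) • Matrix.single a i (1 : ℝ) := by
    simp
  rw [this, map_smul]
  rfl

end StiefelTrace

/-! ### Coordinate frames and the proof of both claims -/

theorem partialD_linearIndependent {E : Type*} [NormedAddCommGroup E] [NormedSpace ℝ E] {d : ℕ}
    {Φ : EuclideanSpace ℝ (Fin d) → E} {x : EuclideanSpace ℝ (Fin d)}
    (hinj : Function.Injective (fderiv ℝ Φ x)) :
    LinearIndependent ℝ fun i => partialD i Φ x := by
  have h := (EuclideanSpace.basisFun (Fin d) ℝ).toBasis.linearIndependent.map'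
    (fderiv ℝ Φ x : EuclideanSpace ℝ (Fin d) →ₗ[ℝ] E) (LinearMap.ker_eq_bot.2 hinj)
  simpa [Function.comp_def, partialD] using h

theorem range_fderiv_subset_span_partialD {E : Type*} [NormedAddCommGroup E] [NormedSpace ℝ E]
    {d : ℕ} {Φ : EuclideanSpace ℝ (Fin d) → E} {x : EuclideanSpace ℝ (Fin d)} :
    Set.range (fderiv ℝ Φ x) ⊆ Submodule.span ℝ (Set.range fun i => partialD i Φ x) := by
  rintro _ ⟨y, rfl⟩
  rw [← (EuclideanSpace.basisFun (Fin d) ℝ).sum_repr y, map_sum]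
  refine Submodule.sum_mem _ fun i _ => ?_
  rw [map_smul, EuclideanSpace.basisFun_apply]
  exact Submodule.smul_mem _ _ (Submodule.subset_span ⟨i, rfl⟩)

section Stiefel

variable {n p : ℕ}

/-- The bilinear form whose trace over the tangent space of the Stiefel manifold at `U` is the
Laplace-Beltrami operator applied to the restriction of `f`. -/
def stiefelHessian (f : Matrix (Fin n) (Fin p) ℝ → ℝ) (U : Matrix (Fin n) (Fin p) ℝ) :
    Matrix (Fin n) (Fin p) ℝ →ₗ[ℝ] Matrix (Fin n) (Fin p) ℝ →ₗ[ℝ] ℝ :=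
  LinearMap.mk₂ ℝ
    (fun Y Z => fderiv ℝ (fderiv ℝ f) U Y Z
      - (1 / 2) * fderiv ℝ f U (U * (Yᵀ * Z + Zᵀ * Y)))
    (fun Y Y' Z => by
      simp only [map_add, Matrix.transpose_add, Matrix.add_mul, Matrix.mul_add, add_apply]
      ring)
    (fun c Y Z => by
      simp only [map_smul, Matrix.transpose_smul, Matrix.smul_mul, Matrix.mul_smul, smul_apply,
        ← smul_add, smul_eq_mul]
      ring)
    (fun Y Z Z' => by
      simp only [map_add, Matrix.transpose_add, Matrix.add_mul, Matrix.mul_add]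
      ring)
    (fun c Y Z => by
      simp only [map_smul, Matrix.transpose_smul, Matrix.smul_mul, Matrix.mul_smul,
        ← smul_add, smul_eq_mul]
      ring)

theorem stiefelHessian_apply (f : Matrix (Fin n) (Fin p) ℝ → ℝ) (U Y Z : Matrix (Fin n) (Fin p) ℝ) :
    stiefelHessian f U Y Z = fderiv ℝ (fderiv ℝ f) U Y Z
      - (1 / 2) * fderiv ℝ f U (U * (Yᵀ * Z + Zᵀ * Y)) := rfl

theorem sum_stiefelHessian (f : Matrix (Fin n) (Fin p) ℝ → ℝ) {U : Matrix (Fin n) (Fin p) ℝ}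
    (hU : U ∈ stiefel n p) :
    ∑ α, stiefelHessian f U (stiefelProj U (frobeniusBasis n p α)) (frobeniusBasis n p α) =
      Laplacian.laplacian f U
        - ((n : ℝ) - ((p : ℝ) + 1) / 2) * Matrix.trace (Uᵀ * gradient f U)
        - (1 / 2) * Matrix.trace (((1 : Matrix (Fin p) (Fin p) ℝ) ⊗ₖ (U * Uᵀ)
            + lambdaMatrix U) * hessianMatrix f U) := by
  set c : ℝ := (n : ℝ) - ((p : ℝ) + 1) / 2 with hc
  have hlap : Laplacian.laplacian f U =
      ∑ α : Fin n × Fin p, fderiv ℝ (fderiv ℝ f) U (Matrix.single α.1 α.2 1)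
        (Matrix.single α.1 α.2 1) := by
    rw [InnerProductSpace.laplacian_eq_iteratedFDeriv_orthonormalBasis f (frobeniusBasis n p)]
    refine Finset.sum_congr rfl fun α _ => ?_
    rw [iteratedFDeriv_two_apply, frobeniusBasis_apply]
    rfl
  have hgrad : Matrix.trace (Uᵀ * gradient f U) = fderiv ℝ f U U := by
    rw [← frobenius_inner_def, real_inner_comm]
    exact inner_gradient_left
  have hsum := sum_single_transpose_mul_stiefelProj hU
  have hsum' := congrArg Matrix.transpose hsum
  simp only [Matrix.transpose_sum, Matrix.transpose_mul, Matrix.transpose_transpose,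
    Matrix.transpose_smul, Matrix.transpose_one] at hsum'
  -- The constant sum and its transpose contribute equally; the resulting factor `2` cancels the `1
  -- / 2` in `stiefelHessian`.
  have hfirst : ∑ α : Fin n × Fin p, fderiv ℝ f U
      (U * ((stiefelProj U (Matrix.single α.1 α.2 (1 : ℝ)))ᵀ * Matrix.single α.1 α.2 (1 : ℝ)
        + (Matrix.single α.1 α.2 (1 : ℝ))ᵀ * stiefelProj U (Matrix.single α.1 α.2 (1 : ℝ)))) =
      2 * (c * fderiv ℝ f U U) := by
    rw [← map_sum, ← Matrix.mul_sum, Finset.sum_add_distrib, hsum, hsum', ← two_smul ℝ,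
      Matrix.mul_smul, Matrix.mul_smul, Matrix.mul_one, map_smul, map_smul]
    rfl
  have hsecond : ∀ α : Fin n × Fin p, fderiv ℝ (fderiv ℝ f) U
      (stiefelProj U (Matrix.single α.1 α.2 1)) (Matrix.single α.1 α.2 1) =
      fderiv ℝ (fderiv ℝ f) U (Matrix.single α.1 α.2 1) (Matrix.single α.1 α.2 1)
        - (1 / 2) * fderiv ℝ (fderiv ℝ f) U (U * symPart U (Matrix.single α.1 α.2 1))
          (Matrix.single α.1 α.2 1) := by
    intro α
    rw [stiefelProj_apply, map_sub, map_smul]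
    rfl
  simp_rw [stiefelHessian_apply, frobeniusBasis_apply]
  rw [Finset.sum_sub_distrib, ← Finset.mul_sum, hfirst, Finset.sum_congr rfl fun α _ => hsecond α,
    Finset.sum_sub_distrib, ← Finset.mul_sum, ← hlap,
    trace_kronecker_add_lambdaMatrix_mul_hessianMatrix, hgrad]
  ring

theorem hasLaplaceBeltramiAt_stiefel {f : Matrix (Fin n) (Fin p) ℝ → ℝ} (hf : ContDiff ℝ ∞ f)
    (U : stiefel n p) :
    HasLaplaceBeltramiAt (stiefel n p) (fun X => f X) U
      (∑ α, stiefelHessian f U (stiefelProj U (frobeniusBasis n p α)) (frobeniusBasis n p α)) := by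
  refine ⟨exists_isLocalParametrization_stiefel U, fun d φ hφ hU => ?_⟩
  set x := φ.symm U with hx
  have hxs : x ∈ φ.source := φ.map_target hU
  set Φ : EuclideanSpace ℝ (Fin d) → Matrix (Fin n) (Fin p) ℝ := fun y => φ y with hΦdef
  have hΦx : Φ x = U := by rw [hΦdef]; exact congrArg Subtype.val (φ.right_inv hU)
  have hev : ∀ᶠ y in nhds x, ContDiffAt ℝ ∞ Φ y :=
    Filter.eventually_of_mem (φ.open_source.mem_nhds hxs) fun y hy => hφ.contDiffAt hy
  have hS : ∀ᶠ y in nhds x, Φ y ∈ stiefel n p := Filter.Eventually.of_forall fun y => (φ y).2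
  have hP : ∀ z, ∑ i, ∑ l, ((Matrix.gram ℝ fun i => partialD i Φ x)⁻¹ i l *
      inner ℝ (partialD l Φ x) z) • partialD i Φ x = stiefelProj (Φ x) z := fun z => by
    refine gram_inv_sum_eq_of_mem_span (partialD_linearIndependent (hφ.immersive x hxs)) ?_
      fun l => inner_sub_stiefelProj (symPart_partialD hev.self_of_nhds hS l) z
    refine range_fderiv_subset_span_partialD (hφ.tangentVectors_subset_range hU ?_)
    rw [tangentVectors_stiefel U.2, hΦx]
    exact symPart_stiefelProj U.2 z
  rw [← hΦx, ← sum_gram_inv_mul_bilin (frobeniusBasis n p) hP]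
  refine (chartLaplaceBeltrami_comp hf hev hP).trans ?_
  refine Finset.sum_congr rfl fun i _ => Finset.sum_congr rfl fun j _ => ?_
  rw [partialD_partialD_sub_stiefelProj hev hS, stiefelHessian_apply, map_neg, map_smul,
    smul_eq_mul, sub_eq_add_neg]
  rfl

theorem IsTangentFrame.mul_inv_mul_transpose {k : ℕ} {U : Matrix (Fin n) (Fin p) ℝ}
    (hU : U ∈ stiefel n p) {T : Matrix (Fin p × Fin n) (Fin k) ℝ} (hT : IsTangentFrame U T) :
    T * (Tᵀ * T)⁻¹ * Tᵀ =
      1 - (1 / 2 : ℝ) • ((1 : Matrix (Fin p) (Fin p) ℝ) ⊗ₖ (U * Uᵀ))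
        - (1 / 2 : ℝ) • lambdaMatrix U := by
  obtain ⟨hli, hspan⟩ := hT
  rw [tangentVectors_stiefel hU] at hspan
  let vecL : Matrix (Fin n) (Fin p) ℝ →ₗ[ℝ] (Fin p × Fin n → ℝ) :=
    { toFun := Matrix.vec, map_add' := Matrix.vec_add, map_smul' := Matrix.vec_smul }
  let v : Fin k → Matrix (Fin n) (Fin p) ℝ := fun l => Matrix.of fun a i => T (i, a) l
  have hv : vecL ∘ v = T.col := rfl
  have hvi : LinearIndependent ℝ v := LinearIndependent.of_comp vecL (hv ▸ hli)
  have hvm : ∀ l, symPart U (v l) = 0 := fun l => by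
    have h : T.col l ∈ Matrix.vec '' {Z | symPart U Z = 0} := by
      rw [← hspan]; exact Submodule.subset_span ⟨l, rfl⟩
    obtain ⟨Z, hZ, hZl⟩ := h
    have : Z = v l := Matrix.vec_inj.1 hZl
    rw [← this]; exact hZ
  have hinner : ∀ l Z, inner ℝ (v l) Z = (Tᵀ *ᵥ Z.vec) l := fun l Z => by
    rw [frobenius_inner_def, Matrix.trace, Matrix.mulVec, dotProduct, Fintype.sum_prod_type]
    rfl
  -- Vectorization is an isometry for the Frobenius product, so the Gram lemma applies to the
  -- columns of `T` read as matrices.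
  have hgram : Tᵀ * T = Matrix.gram ℝ v := by
    ext i j
    rw [Matrix.gram_apply, hinner]
    rfl
  have hproj : ∀ Z, ∑ i, ∑ l, ((Matrix.gram ℝ v)⁻¹ i l * inner ℝ (v l) Z) • v i =
      stiefelProj U Z := fun Z => by
    refine gram_inv_sum_eq_of_mem_span hvi ?_ fun l => inner_sub_stiefelProj (hvm l) Z
    have h : vecL (stiefelProj U Z) ∈ Submodule.span ℝ (Set.range T.col) := by
      rw [← SetLike.mem_coe, hspan]
      exact ⟨_, symPart_stiefelProj hU Z, rfl⟩
    rw [← hv, Set.range_comp, Submodule.span_image] at h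
    obtain ⟨W, hW, hWZ⟩ := h
    have hW' : W = stiefelProj U Z := Matrix.vec_inj.1 hWZ
    rwa [← hW']
  have key : ∀ Z : Matrix (Fin n) (Fin p) ℝ, (T * (Tᵀ * T)⁻¹ * Tᵀ) *ᵥ Z.vec =
      (1 - (1 / 2 : ℝ) • ((1 : Matrix (Fin p) (Fin p) ℝ) ⊗ₖ (U * Uᵀ))
        - (1 / 2 : ℝ) • lambdaMatrix U) *ᵥ Z.vec := fun Z => by
    rw [sub_sub, ← smul_add, Matrix.sub_mulVec, Matrix.smul_mulVec,
      kronecker_add_lambdaMatrix_mulVec, Matrix.one_mulVec, ← Matrix.vec_smul, ← Matrix.vec_sub,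
      ← stiefelProj_apply, ← hproj, ← Matrix.mulVec_mulVec, ← Matrix.mulVec_mulVec, hgram]
    ext ⟨i, a⟩
    simp only [Matrix.mulVec, dotProduct, Matrix.vec, Matrix.sum_apply, Matrix.smul_apply,
      smul_eq_mul]
    refine Finset.sum_congr rfl fun l _ => ?_
    rw [Finset.mul_sum]
    refine Finset.sum_congr rfl fun m _ => ?_
    rw [hinner, mul_comm]
    rfl
  -- Coordinate vectors are vectorized matrix units, so agreement on all `vec Z` determines the
  -- matrix.
  refine Matrix.ext_of_mulVec_single fun r => ?_
  have := key (Matrix.single r.2 r.1 1)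
  rwa [Matrix.vec_single] at this

end Stiefel

end

theorem theorem1p2 (n p : ℕ) (hp : 1 ≤ p) (hpn : p ≤ n) :
    (∀ (ft : stiefel n p → ℝ) (f : Matrix (Fin n) (Fin p) ℝ → ℝ),
      SmoothOnSubmanifold (stiefel n p) ft →
      ContDiff ℝ ∞ f →
      (∀ U : stiefel n p, f U = ft U) →
      ∀ U : stiefel n p,
        HasLaplaceBeltramiAt (stiefel n p) ft U
          (Laplacian.laplacian f (U : Matrix (Fin n) (Fin p) ℝ)
            - ((n : ℝ) - ((p : ℝ) + 1) / 2) *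
                Matrix.trace ((U : Matrix (Fin n) (Fin p) ℝ)ᵀ * gradient f U)
            - (1 / 2) * Matrix.trace
                (((1 : Matrix (Fin p) (Fin p) ℝ) ⊗ₖ ((U : Matrix (Fin n) (Fin p) ℝ) * Uᵀ)
                  + lambdaMatrix (U : Matrix (Fin n) (Fin p) ℝ)) * hessianMatrix f U))) ∧
    (∀ (U : stiefel n p) (k : ℕ) (T : Matrix (Fin p × Fin n) (Fin k) ℝ),
      IsTangentFrame (U : Matrix (Fin n) (Fin p) ℝ) T →
        T * (Tᵀ * T)⁻¹ * Tᵀ =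
          1 - (1 / 2 : ℝ) • ((1 : Matrix (Fin p) (Fin p) ℝ) ⊗ₖ
                ((U : Matrix (Fin n) (Fin p) ℝ) * Uᵀ))
            - (1 / 2 : ℝ) • lambdaMatrix (U : Matrix (Fin n) (Fin p) ℝ)) := by
  refine ⟨fun ft f _ hf hft U => ?_, fun U k T hT => hT.mul_inv_mul_transpose U.2⟩
  obtain rfl : (fun X : stiefel n p => f X) = ft := funext hft
  have h := hasLaplaceBeltramiAt_stiefel hf U
  rw [sum_stiefelHessian f U.2] at h
  exact h
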